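/- Let $K$ be a field and let $\mathcal F$ be the free non-symmetric operad over $K$ generated by one binary operation $(\,,)$; a basis of its component $\mathcal F(n)$ is given by the planar rooted binary trees with $n$ leaves (tree monomials, including the one-leaf tree, the identity operation). A total order on the tree monomials of each arity is called admissible if every partial composition $\circ_i$ is strictly increasing in each of its two arguments. For an ideal $C=\bigcup_n C(n)$ of $\mathcal F$ let $\widehat C(n)$ be the span of the leading monomials of the nonzero elements of $C(n)$; a set of (arity-homogeneous) elements of $C$ is a Gröbner basis of $C$ if their leading monomials generate the ideal $\widehat C$. Let $k>2$, let $$r_k=(x_1,(x_2,(\dots,(x_{k-2},(x_{k-1},x_k,x_{k+1}))\dots)))\in\mathcal F(k+1),$$ where $(a,b,c)=((a,b),c)-(a,(b,c))$ is the associator, and let $\mathcal Q_k$ be the non-symmetric operad generated by one binary operation subject to the relation $r_k=0$, so that its ideal of relations is the ideal of $\mathcal F$ generated by $r_k$. Then, for every admissible order for which the leading monomial of $r_k$ is $(x_1,(\dots,(x_{k-2},((x_{k-1},x_k),x_{k+1}))\dots))$, the single element $r_k$ is a Gröbner basis of the ideal of relations of $\mathcal Q_k$. The path-lexicographic order (compare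 the depths of the leaves one after another from left to right; at the first difference the tree with the deeper leaf is larger) is an admissible order with this property. -/

import Mathlib

/-! The free non-symmetric operad on one binary operation, its operadic ideals, admissible
orders on tree monomials, Gröbner bases, and the weak associativity relation `r_k`. -/

namespace WeakAssoc

/-- Planar tree monomials in one binary operation: planar rooted binary trees. `nil` is the
trivial monomial (the identity operation, a single leaf), `node () s t` is the operation `(s, t)`.
The arity of a monomial is `BinaryTree.numLeaves`. -/
abbrev Mon : Type := BinaryTree Unit

namespace Mon

/-- `graft t i s`: the composition `t ∘_i s`, which substitutes `s` for the `i`-th leaf of `t`.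
Leaves are numbered `0, 1, …` from left to right; used only for `i < t.numLeaves`. -/
def graft : Mon → ℕ → Mon → Mon
  | .nil, _, s => s
  | .node _ l r, i, s =>
      if i < l.numLeaves then .node () (graft l i s) r
      else .node () l (graft r (i - l.numLeaves) s)

/-- The list of depths of the leaves, from left to right. As there is a single generator, the
depth of a leaf is the word read along the path from the root to this leaf. -/
def leafDepths : Mon → List ℕ
  | .nil => [0]
  | .node _ l r => (leafDepths l ++ leafDepths r).map (· + 1)

end Mon

/-- An order on tree monomials (compared only within one arity) is admissible if it is a strict
total order in each arity, and each partial composition is strictly increasing in each of its two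
arguments. Each arity has finitely many monomials, hence well-foundedness is automatic. -/
structure IsAdmissible (lt : Mon → Mon → Prop) : Prop where
  irrefl : ∀ t, ¬ lt t t
  trans : ∀ s t u, s.numLeaves = t.numLeaves → t.numLeaves = u.numLeaves →
    lt s t → lt t u → lt s u
  total : ∀ s t, s.numLeaves = t.numLeaves → s ≠ t → lt s t ∨ lt t s
  graft_left : ∀ s t u i, s.numLeaves = t.numLeaves → i < s.numLeaves → lt s t →
    lt (Mon.graft s i u) (Mon.graft t i u)
  graft_right : ∀ s t u i, s.numLeaves = t.numLeaves → i < u.numLeaves → lt s t →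
    lt (Mon.graft u i s) (Mon.graft u i t)

/-- The path-lexicographic order: compare the paths to the leaves one after another, from left to
right; at the first difference the monomial with the longer path is the larger one. -/
def pathLex (s t : Mon) : Prop :=
  List.Lex (· < ·) s.leafDepths t.leafDepths

section

variable (K : Type*) [Field K]

/-- The total space of the free non-symmetric operad over `K` on one binary operation: linear
combinations of tree monomials. -/
abbrev Free : Type _ := Mon →₀ K

/-- The component of arity `n` of the free operad. -/
noncomputable def arity (n : ℕ) : Submodule K (Free K) :=
  Finsupp.supported K K {t : Mon | t.numLeaves = n}

variable {K}

/-- The partial composition `f ∘_i g`, the bilinear extension of the grafting of trees. It is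
used only for `f` of arity greater than `i`. -/
noncomputable def comp (i : ℕ) (f g : Free K) : Free K :=
  f.sum fun t a => g.sum fun s b => Finsupp.single (Mon.graft t i s) (a * b)

/-- A family of subspaces `C n` of the components of the free operad is an (operadic, two-sided)
ideal if it is closed under the partial compositions with arbitrary elements of the free operad. -/
structure IsOperadIdeal (C : ℕ → Submodule K (Free K)) : Prop where
  le_arity : ∀ n, C n ≤ arity K n
  comp_left : ∀ m n i, i < m → ∀ f ∈ C m, ∀ g ∈ arity K n, comp i f g ∈ C (m + n - 1)
  comp_right : ∀ m n i, i < m → ∀ f ∈ arity K m, ∀ g ∈ C n, comp i f g ∈ C (m + n - 1)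

/-- The component of arity `n` of the ideal generated by a set `G` of elements of the components of
the free operad: the intersection of all ideals containing `G`, within the component of arity `n`
of the free operad. -/
noncomputable def idealGen (G : Set (Free K)) (n : ℕ) : Submodule K (Free K) :=
  arity K n ⊓ sInf {S | ∃ C : ℕ → Submodule K (Free K), IsOperadIdeal C ∧
    (∀ g ∈ G, ∀ m, g ∈ arity K m → g ∈ C m) ∧ S = C n}

/-- `t` is the leading monomial of `f`, an element of some component of the free operad. -/
def IsLeadingMonomial (lt : Mon → Mon → Prop) (f : Free K) (t : Mon) : Prop :=
  t ∈ f.support ∧ ∀ s ∈ f.support, s ≠ t → lt s t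

/-- The span of the leading monomials of all elements of `C n`. -/
noncomputable def leadingSpan (lt : Mon → Mon → Prop) (C : ℕ → Submodule K (Free K)) (n : ℕ) :
    Submodule K (Free K) :=
  Submodule.span K {x | ∃ f ∈ C n, ∃ t, IsLeadingMonomial lt f t ∧ x = Finsupp.single t 1}

/-- `G` is a Gröbner basis of the ideal `C`: it consists of elements of `C`, and the leading
monomials of the elements of `G` generate the monomial ideal spanned by the leading monomials of
all elements of `C`. -/
def IsGroebnerBasis (lt : Mon → Mon → Prop) (C : ℕ → Submodule K (Free K))
    (G : Set (Free K)) : Prop :=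
  (∀ g ∈ G, ∃ n, g ∈ C n) ∧
  ∀ n, idealGen {x : Free K | ∃ g ∈ G, ∃ t, IsLeadingMonomial lt g t ∧ x = Finsupp.single t 1} n
    = leadingSpan lt C n

/-- The operation `(f, g)`, the bilinear extension of `node`; the inputs of `f` precede those
of `g`. -/
noncomputable def op (f g : Free K) : Free K :=
  f.sum fun s a => g.sum fun t b => Finsupp.single (BinaryTree.node () s t) (a * b)

/-- The associator `(f, g, h) = (fg)h - f(gh)`. -/
noncomputable def assoc (f g h : Free K) : Free K :=
  op (op f g) h - op f (op g h)

variable (K)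

/-- An input `x`. In a non-symmetric operad the inputs of an operation are numbered from left to
right, hence their names are determined by their places. -/
noncomputable def input : Free K := Finsupp.single BinaryTree.nil 1

/-- The element `r_k = (x_1, (…, (x_{k-2}, (x_{k-1}, x_k, x_{k+1})) …))` of arity `k + 1`,
for `k ≥ 2`. -/
noncomputable def r (k : ℕ) : Free K :=
  (op (input K))^[k - 2] (assoc (input K) (input K) (input K))

/-- The ideal of relations of the non-symmetric operad `Q_k`, that is, of the quotient of the free
operad by the relation `r_k = 0`. -/
noncomputable def relationsQ (k : ℕ) : ℕ → Submodule K (Free K) := idealGen {r K k}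

end

/-- The monomial `(x_1, (…, (x_{k-2}, ((x_{k-1}, x_k), x_{k+1})) …))`. -/
def leadTree (k : ℕ) : Mon :=
  (BinaryTree.node () .nil)^[k - 2] (.node () (.node () .nil .nil) .nil)

end WeakAssoc

namespace WeakAssoc

open BinaryTree

namespace Mon

/-! No S-polynomials are computed; an explicit normal form does the work. Put `m = k - 2`. Starting
at the root, and again at every left child, walk `m` steps to the right and replace the subtree
reached by the right comb of the same size; this is `nf m t m`.

On the one hand, the normal form of a composition depends only on the normal forms of its factors
(`nf_graft`). So the kernel of its linear extension is an operadic ideal, and as it contains `r_k`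
it contains all relations (`relationsQ_le_ker`). On the other hand, every monomial is led to its
normal form by rewriting with `r_k` (`IsReduction.nf`). For an admissible order, a monomial that is
not normal is therefore larger than its normal form and lies in the monomial ideal of the leading
monomial of `r_k` (`isReduction_of_isAdmissible`).

If the leading monomial of a relation were normal, no other monomial of that relation could have the
same normal form, so its coefficient would survive in the image, which is zero
(`nf_ne_of_isLeadingMonomial`). Hence it is not normal, and lies in the required ideal. -/

theorem numNodes_graft (t s : Mon) (i : ℕ) (hi : i < t.numLeaves) :
    (graft t i s).numNodes = t.numNodes + s.numNodes := by
  induction t generalizing i with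
  | nil => simp [graft]
  | node a l r ihl ihr =>
    simp only [BinaryTree.numLeaves] at hi
    by_cases h : i < l.numLeaves
    · simp only [graft, h, if_true, BinaryTree.numNodes, ihl i h]; omega
    · simp only [graft, h, if_false, BinaryTree.numNodes, ihr (i - l.numLeaves) (by omega)]; omega

theorem numLeaves_graft (t s : Mon) (i : ℕ) (hi : i < t.numLeaves) :
    (graft t i s).numLeaves = t.numLeaves + s.numLeaves - 1 := by
  have := numNodes_graft t s i hi
  simp only [BinaryTree.numLeaves_eq_numNodes_succ] at *
  omega

/-! ### Right combs and normal forms -/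

/-- The monomial `(x_1, (…, (x_j, t) …))`. -/
def comb (j : ℕ) (t : Mon) : Mon := (BinaryTree.node () .nil)^[j] t

@[simp] theorem comb_zero (t : Mon) : comb 0 t = t := rfl

theorem comb_succ (j : ℕ) (t : Mon) : comb (j + 1) t = .node () .nil (comb j t) :=
  Function.iterate_succ_apply' _ _ _

theorem comb_succ' (j : ℕ) (t : Mon) : comb (j + 1) t = comb j (.node () .nil t) :=
  Function.iterate_succ_apply _ _ _

@[simp] theorem numNodes_comb (j : ℕ) (t : Mon) : (comb j t).numNodes = j + t.numNodes := by
  induction j with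
  | zero => simp
  | succ j ih => simp [comb_succ, BinaryTree.numNodes, ih]; omega

theorem numLeaves_comb (j : ℕ) (t : Mon) : (comb j t).numLeaves = j + t.numLeaves := by
  simp only [BinaryTree.numLeaves_eq_numNodes_succ, numNodes_comb]; omega

theorem graft_comb (j i : ℕ) (t s : Mon) : graft (comb j t) (j + i) s = comb j (graft t i s) := by
  induction j with
  | zero => simp
  | succ j ih =>
    have h : j + 1 + i - 1 = j + i := by omega
    simp [comb_succ, graft, BinaryTree.numLeaves, h, ih]

/-- The normal form of a monomial modulo `r_(m+2)`, at a vertex from which `d` more steps to the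
right are to be made before the weak associativity relation applies. -/
def nf (m : ℕ) : Mon → ℕ → Mon
  | .nil, _ => .nil
  | .node _ l r, 0 => comb (BinaryTree.node () l r).numNodes .nil
  | .node _ l r, d + 1 => .node () (nf m l m) (nf m r d)

theorem nf_zero (m : ℕ) (t : Mon) : nf m t 0 = comb t.numNodes .nil := by
  cases t <;> rfl

@[simp] theorem numNodes_nf (m : ℕ) (t : Mon) (d : ℕ) : (nf m t d).numNodes = t.numNodes := by
  induction t generalizing d with
  | nil => rfl
  | node a l r ihl ihr =>
    cases d with
    | zero => simp [nf_zero]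
    | succ d => simp [nf, BinaryTree.numNodes, ihl, ihr]

@[simp] theorem numLeaves_nf (m : ℕ) (t : Mon) (d : ℕ) : (nf m t d).numLeaves = t.numLeaves := by
  simp only [BinaryTree.numLeaves_eq_numNodes_succ, numNodes_nf]

/-- A smaller counter flattens larger subtrees, and flattening remembers only the number of nodes,
so the milder normalisation leaves no trace. -/
theorem nf_nf (m : ℕ) (t : Mon) (d e : ℕ) (h : d ≤ e) : nf m (nf m t e) d = nf m t d := by
  induction t generalizing d e with
  | nil => rfl
  | node a l r ihl ihr =>
    cases d with
    | zero => simp [nf_zero]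
    | succ d =>
      obtain ⟨e, rfl⟩ : ∃ e', e = e' + 1 := ⟨e - 1, by omega⟩
      simp only [nf, ihl m m le_rfl, ihr d e (by omega)]

/-- At counter `0` only the number of nodes matters. At a leaf of `t` the remaining counter is at
most `m`, so normalising `s` beforehand with counter `m` is absorbed by `nf_nf`. -/
theorem nf_graft (m : ℕ) (t s : Mon) (i d : ℕ) (hi : i < t.numLeaves) (hd : d ≤ m) :
    nf m (graft t i s) d = nf m (graft (nf m t d) i (nf m s m)) d := by
  induction t generalizing i d with
  | nil => simp [graft, nf, nf_nf m s d m hd]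
  | node a l r ihl ihr =>
    cases d with
    | zero =>
      rw [nf_zero, nf_zero, numNodes_graft _ _ _ hi, numNodes_graft _ _ _ (by simpa using hi)]
      simp
    | succ d =>
      simp only [BinaryTree.numLeaves] at hi
      by_cases h : i < l.numLeaves
      · simp [graft, h, nf, ihl i m h le_rfl, nf_nf m r d d le_rfl]
      · simp [graft, h, nf, ihr (i - l.numLeaves) d (by omega) (by omega), nf_nf m l m m le_rfl]

theorem nf_comb (m j d : ℕ) (t : Mon) : nf m (comb j t) (d + j) = comb j (nf m t d) := by
  induction j with
  | zero => rfl
  | succ j ih => simp [comb_succ, ← add_assoc, nf, ih]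

/-! ### Rewriting a monomial to its normal form -/

/-- A preorder on monomials which respects the arities and is compatible with grafting, and which
relates the two monomials of `r_(m+2)`. -/
structure IsReduction (m : ℕ) (Q : Mon → Mon → Prop) : Prop where
  refl : ∀ t, Q t t
  trans : ∀ s t u, Q s t → Q t u → Q s u
  graft_left : ∀ s t u i, i < s.numLeaves → Q s t → Q (graft s i u) (graft t i u)
  graft_right : ∀ s t u i, i < u.numLeaves → Q s t → Q (graft u i s) (graft u i t)
  base : Q (comb m (.node () (.node () .nil .nil) .nil))
    (comb m (.node () .nil (.node () .nil .nil)))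

namespace IsReduction

variable {m : ℕ} {Q : Mon → Mon → Prop}

theorem comb_congr (hQ : IsReduction m Q) (j : ℕ) {s t : Mon} (h : Q s t) :
    Q (comb j s) (comb j t) := by
  have := hQ.graft_right s t (comb j .nil) (j + 0)
    (by simp [numLeaves_comb, BinaryTree.numLeaves]) h
  simpa only [graft_comb, graft] using this

theorem comb_node_left (hQ : IsReduction m Q) (j : ℕ) {s t : Mon} (r : Mon) (h : Q s t) :
    Q (comb j (.node () s r)) (comb j (.node () t r)) := by
  refine hQ.comb_congr j ?_
  have := hQ.graft_right s t (.node () .nil r) 0 (by simp [BinaryTree.numLeaves]) h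
  simpa [graft, BinaryTree.numLeaves] using this

/-- The extra step to the right in the hypothesis supplies a trivial leaf at position `j`, into
which `l` is grafted. -/
theorem comb_node_right (hQ : IsReduction m Q) (j : ℕ) {s t : Mon} (l : Mon)
    (h : Q (comb (j + 1) s) (comb (j + 1) t)) :
    Q (comb j (.node () l s)) (comb j (.node () l t)) := by
  have := hQ.graft_left _ _ l (j + 0) (by simp [numLeaves_comb]; omega) h
  simp only [comb_succ', graft_comb] at this
  simpa [graft, BinaryTree.numLeaves] using this

theorem comb_assoc (hQ : IsReduction m Q) (j : ℕ) (hj : m ≤ j) (a b c : Mon) :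
    Q (comb j (.node () (.node () a b) c)) (comb j (.node () a (.node () b c))) := by
  obtain ⟨e, rfl⟩ := Nat.exists_eq_add_of_le' hj
  have key : Q (comb m (.node () (.node () a b) c)) (comb m (.node () a (.node () b c))) := by
    -- The last three leaves are filled from right to left, so that the positions still to be filled
    -- do not shift.
    have h1 := hQ.graft_left _ _ c (m + 2) (by simp [numLeaves_comb, BinaryTree.numLeaves])
      hQ.base
    simp only [graft_comb] at h1
    simp [graft, BinaryTree.numLeaves] at h1
    have h2 := hQ.graft_left _ _ b (m + 1)
      (by simp [numLeaves_comb, BinaryTree.numLeaves]; omega) h1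
    simp only [graft_comb] at h2
    simp [graft, BinaryTree.numLeaves] at h2
    have h3 := hQ.graft_left _ _ a (m + 0) (by simp [numLeaves_comb, BinaryTree.numLeaves]) h2
    simp only [graft_comb] at h3
    simpa [graft, BinaryTree.numLeaves] using h3
  have := hQ.comb_congr e key
  simpa only [comb, ← Function.iterate_add_apply] using this

/-- Below `m` right steps associativity applies at every vertex of the right spine. Rotating `((a,
b), r)` to `(a, (b, r))` shortens the left factor, whence the inner induction on `l` for all `r`;
once `l` is a leaf, the walk moves one step right. -/
theorem comb_flatten (hQ : IsReduction m Q) (t : Mon) (j : ℕ) (hj : m ≤ j) :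
    Q (comb j t) (comb j (comb t.numNodes .nil)) := by
  have node_case : ∀ l r : Mon,
      (∀ j, m ≤ j → Q (comb j r) (comb j (comb r.numNodes .nil))) → ∀ j, m ≤ j →
      Q (comb j (.node () l r)) (comb j (comb (BinaryTree.node () l r).numNodes .nil)) := by
    intro l
    induction l with
    | nil =>
      intro r hr j hj
      have := hr (j + 1) (by omega)
      simpa [BinaryTree.numNodes, comb_succ' j, comb_succ r.numNodes] using this
    | node _ a b iha ihb =>
      intro r hr j hj
      have h := iha (.node () b r) (ihb r hr) j hj
      have e : (BinaryTree.node () a (.node () b r)).numNodes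
          = (BinaryTree.node () (.node () a b) r).numNodes := by
        simp only [BinaryTree.numNodes]; omega
      rw [e] at h
      exact hQ.trans _ _ _ (hQ.comb_assoc j hj a b r) h
  induction t generalizing j with
  | nil => exact hQ.refl _
  | node _ l r _ ihr => exact node_case l r (fun j hj => ihr j hj) j hj

theorem comb_nf (hQ : IsReduction m Q) (t : Mon) (j d : ℕ) (h : m ≤ j + d) :
    Q (comb j t) (comb j (nf m t d)) := by
  induction t generalizing j d with
  | nil => exact hQ.refl _
  | node _ l r ihl ihr =>
    cases d with
    | zero => rw [nf_zero]; exact hQ.comb_flatten _ j h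
    | succ d =>
      -- In the right subtree one more step has been made and one fewer remains; the left subtree is
      -- rewritten on its own, with `0` steps made and `m` to go.
      exact hQ.trans _ _ _ (hQ.comb_node_right j l (ihr (j + 1) d (by omega)))
        (hQ.comb_node_left j _ (ihl 0 m (by omega)))

theorem nf (hQ : IsReduction m Q) (t : Mon) : Q t (nf m t m) :=
  hQ.comb_nf t 0 m (by omega)

end IsReduction

/-! ### The path-lexicographic order -/

@[simp] theorem length_leafDepths (t : Mon) : t.leafDepths.length = t.numLeaves := by
  induction t with
  | nil => rfl
  | node _ l r ihl ihr => simp [leafDepths, BinaryTree.numLeaves, ihl, ihr]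

/-- The depth `d` of the chosen leaf is replaced by the depths of `s` shifted by `d`; the other
depths are untouched. -/
theorem leafDepths_graft (t s : Mon) (p q : List ℕ) (d : ℕ) (h : t.leafDepths = p ++ d :: q) :
    (graft t p.length s).leafDepths = p ++ (s.leafDepths.map (· + d) ++ q) := by
  induction t generalizing p q d with
  | nil =>
    rcases p with _ | ⟨x, p⟩
    · simp [leafDepths] at h
      obtain ⟨rfl, rfl⟩ := h
      simp [graft]
    · simp [leafDepths] at h
  | node _ l r ihl ihr =>
    simp only [leafDepths, List.map_append] at h
    rcases List.append_eq_append_iff.1 h with ⟨p', rfl, h'⟩ | ⟨q', hl, h'⟩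
    · obtain ⟨p, d, rfl, q, hr, rfl, rfl⟩ : ∃ p d', p' = p.map (· + 1) ∧ ∃ q',
          leafDepths r = p ++ d' :: q' ∧ d = d' + 1 ∧ q = q'.map (· + 1) := by
        obtain ⟨p, z, hr, rfl, hz⟩ := List.map_eq_append_iff.1 h'
        obtain ⟨d', q', rfl, rfl, rfl⟩ := List.map_eq_cons_iff.1 hz
        exact ⟨p, d', rfl, q', hr, rfl, rfl⟩
      have := ihr _ _ _ hr
      simp [graft, leafDepths, this]
    · rcases q' with _ | ⟨x, q'⟩
      · simp at hl h'
        subst hl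
        obtain ⟨d', q', hr, rfl, rfl⟩ := List.map_eq_cons_iff.1 h'.symm
        have := ihr [] _ _ hr
        simp at this
        simp [graft, leafDepths, this]
      · simp only [List.cons_append, List.cons.injEq] at h'
        obtain ⟨rfl, rfl⟩ := h'
        obtain ⟨p, z, hl', rfl, hz⟩ := List.map_eq_append_iff.1 hl
        obtain ⟨d', q', rfl, rfl, rfl⟩ := List.map_eq_cons_iff.1 hz
        have h1 : p.length < l.numLeaves := by simp [← length_leafDepths, hl']
        have := ihl _ _ _ hl'
        simp [graft, leafDepths, this, h1]

/-- Depth words are uniquely decodable: with shift `c`, a leaf begins with `c` and a node with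
something larger. The tails `x`, `y` let the induction peel off one subtree at a time. -/
theorem leafDepths_append_inj (s t : Mon) (c : ℕ) (x y : List ℕ)
    (h : s.leafDepths.map (· + c) ++ x = t.leafDepths.map (· + c) ++ y) : s = t ∧ x = y := by
  have head : ∀ t : Mon, ∀ c x y, c :: x ≠ t.leafDepths.map (· + (1 + c)) ++ y := by
    intro t
    induction t with
    | nil => intro c x y h; simp [leafDepths] at h
    | node _ l r ihl _ =>
      intro c x y h
      cases hl : leafDepths l with
      | nil => simpa [← length_leafDepths, hl] using l.numLeaves_pos
      | cons d q => simp [leafDepths, hl] at h; omega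
  induction s generalizing t c x y with
  | nil =>
    cases t with
    | nil => simpa [leafDepths] using h
    | node _ l r =>
      exact absurd (by simpa [leafDepths, Function.comp_def, add_assoc] using h) (head l c x _)
  | node _ l r ihl ihr =>
    cases t with
    | nil =>
      exact absurd (by simpa [leafDepths, Function.comp_def, add_assoc] using h.symm)
        (head l c y _)
    | node _ l' r' =>
      simp only [leafDepths, List.map_append, List.map_map, List.append_assoc, Function.comp_def,
        add_assoc] at h
      obtain ⟨rfl, h1⟩ := ihl _ _ _ _ h
      obtain ⟨rfl, h2⟩ := ihr _ _ _ _ h1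
      exact ⟨rfl, h2⟩

theorem leafDepths_injective : Function.Injective leafDepths := fun s t h =>
  (leafDepths_append_inj s t 0 [] [] (by simp [h])).1

end Mon

theorem exists_of_lex {x y : List ℕ} (hl : x.length = y.length) (h : List.Lex (· < ·) x y) :
    ∃ p a b x' y', x = p ++ a :: x' ∧ y = p ++ b :: y' ∧ a < b := by
  induction h with
  | nil => simp at hl
  | cons _ ih =>
    obtain ⟨p, a, b, x', y', rfl, rfl, hab⟩ := ih (by simpa using hl)
    exact ⟨_ :: p, a, b, x', y', rfl, rfl, hab⟩
  | rel hab => exact ⟨[], _, _, _, _, rfl, rfl, hab⟩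

theorem lex_append (p : List ℕ) {a b : ℕ} (hab : a < b) (x y : List ℕ) :
    List.Lex (· < ·) (p ++ a :: x) (p ++ b :: y) := by
  induction p with
  | nil => exact .rel hab
  | cons _ _ ih => exact .cons ih

theorem pathLex_isAdmissible : IsAdmissible pathLex where
  irrefl t h := by
    obtain ⟨p, a, b, x', y', h1, h2, hab⟩ := exists_of_lex rfl h
    rw [h1] at h2
    simp at h2
    omega
  trans s t u _ _ h1 h2 := by
    exact List.lt_trans (l₁ := s.leafDepths) (l₂ := t.leafDepths) (l₃ := u.leafDepths) h1 h2
  total s t _ h := by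
    by_contra! hc
    have : Std.Trichotomous (List.Lex ((· < ·) : ℕ → ℕ → Prop)) := inferInstance
    exact h (Mon.leafDepths_injective (this.trichotomous _ _ hc.1 hc.2))
  graft_left s t u i hst hi h := by
    obtain ⟨p, a, b, x, y, hs, ht, hab⟩ := exists_of_lex (by simpa using hst) h
    rw [← Mon.length_leafDepths, hs] at hi
    unfold pathLex
    -- The grafted leaf lies before, at, or after the first difference `a < b`. At it, the new first
    -- difference is between the first depth of `u` shifted by `a` and by `b`; otherwise `a` and `b`
    -- still decide.
    rcases lt_trichotomy i p.length with hip | rfl | hip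
    · obtain ⟨p1, d, p2, rfl, rfl⟩ : ∃ p1 d p2, p = p1 ++ d :: p2 ∧ i = p1.length :=
        ⟨p.take i, p[i], p.drop (i + 1), by simp, by simp; omega⟩
      rw [Mon.leafDepths_graft s u p1 (p2 ++ a :: x) d (by simp [hs]),
        Mon.leafDepths_graft t u p1 (p2 ++ b :: y) d (by simp [ht])]
      simpa using lex_append (p1 ++ (u.leafDepths.map (· + d) ++ p2)) hab x y
    · rw [Mon.leafDepths_graft s u p x a hs, Mon.leafDepths_graft t u p y b ht]
      cases hu : u.leafDepths with
      | nil => simpa [← Mon.length_leafDepths, hu] using u.numLeaves_pos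
      | cons c w => exact lex_append p (Nat.add_lt_add_left hab c) _ _
    · obtain ⟨x1, d, x2, rfl, rfl⟩ : ∃ x1 d x2, x = x1 ++ d :: x2 ∧
          i = p.length + 1 + x1.length := by
        simp at hi
        exact ⟨x.take (i - p.length - 1), x[i - p.length - 1], x.drop (i - p.length - 1 + 1),
          by simp, by simp; omega⟩
      have hl : y.length = x1.length + 1 + x2.length := by
        have : s.leafDepths.length = t.leafDepths.length := by simpa using hst
        simp [hs, ht] at this
        omega
      obtain ⟨y1, e, y2, rfl, hy⟩ : ∃ y1 e y2, y = y1 ++ e :: y2 ∧ y1.length = x1.length :=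
        ⟨y.take x1.length, y[x1.length], y.drop (x1.length + 1), by simp, by simp; omega⟩
      have e1 := Mon.leafDepths_graft s u (p ++ a :: x1) x2 d (by simp [hs])
      have e2 := Mon.leafDepths_graft t u (p ++ b :: y1) y2 e (by simp [ht])
      simp only [List.length_append, List.length_cons, hy] at e1 e2
      rw [show p.length + 1 + x1.length = p.length + (x1.length + 1) by omega, e1, e2]
      simpa using lex_append p hab _ _
  graft_right s t u i hst hi h := by
    obtain ⟨p, a, b, x, y, hs, ht, hab⟩ := exists_of_lex (by simpa using hst) h
    rw [← Mon.length_leafDepths] at hi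
    obtain ⟨p1, d, p2, hu, rfl⟩ : ∃ p1 d p2, u.leafDepths = p1 ++ d :: p2 ∧ i = p1.length :=
      ⟨u.leafDepths.take i, u.leafDepths[i], u.leafDepths.drop (i + 1), by simp,
        by rw [List.length_take]; omega⟩
    unfold pathLex
    rw [Mon.leafDepths_graft u s p1 p2 d hu, Mon.leafDepths_graft u t p1 p2 d hu, hs, ht]
    simpa using lex_append (p1 ++ p.map (· + d)) (Nat.add_lt_add_right hab d) _ _


/-- A strictly increasing map on a totally ordered set is injective, so no combinatorics of trees is
needed. -/
theorem IsAdmissible.graft_injective {lt : Mon → Mon → Prop} (h : IsAdmissible lt) {s t u : Mon}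
    {i : ℕ} (hst : s.numLeaves = t.numLeaves) (hi : i < s.numLeaves)
    (e : Mon.graft s i u = Mon.graft t i u) : s = t := by
  by_contra hne
  rcases h.total s t hst hne with hl | hl
  · exact h.irrefl _ (e ▸ h.graft_left s t u i hst hi hl)
  · exact h.irrefl _ (e ▸ h.graft_left t s u i hst.symm (hst ▸ hi) hl)

theorem IsAdmissible.graft_injective_right {lt : Mon → Mon → Prop} (h : IsAdmissible lt)
    {s t u : Mon} {i : ℕ} (hst : s.numLeaves = t.numLeaves) (hi : i < u.numLeaves)
    (e : Mon.graft u i s = Mon.graft u i t) : s = t := by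
  by_contra hne
  rcases h.total s t hst hne with hl | hl
  · exact h.irrefl _ (e ▸ h.graft_right s t u i hst hi hl)
  · exact h.irrefl _ (e ▸ h.graft_right t s u i hst.symm hi hl)

/-! ### Partial compositions as bilinear maps -/

variable {K : Type*} [Field K]

theorem mem_arity {n : ℕ} {f : Free K} : f ∈ arity K n ↔ ∀ t ∈ f.support, t.numLeaves = n :=
  Iff.rfl

theorem single_mem_arity {n : ℕ} {t : Mon} (h : t.numLeaves = n) (a : K) :
    Finsupp.single t a ∈ arity K n :=
  Finsupp.single_mem_supported K a h

theorem numLeaves_of_single_mem_arity {n : ℕ} {t : Mon}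
    (h : Finsupp.single t (1 : K) ∈ arity K n) : t.numLeaves = n :=
  mem_arity.1 h t (by simp)

theorem map_mem_of_mem_arity {M : Type*} [AddCommGroup M] [Module K M] (φ : Free K →ₗ[K] M)
    (S : Submodule K M) {n : ℕ} (h : ∀ t : Mon, t.numLeaves = n → φ (Finsupp.single t 1) ∈ S)
    {f : Free K} (hf : f ∈ arity K n) : φ f ∈ S := by
  rw [arity, Finsupp.supported_eq_span_single] at hf
  refine Submodule.span_le (p := S.comap φ).2 ?_ hf
  rintro _ ⟨t, ht, rfl⟩
  exact h t ht

/-- The partial composition `∘_i` as a bilinear map. -/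
noncomputable def compL (K : Type*) [Field K] (i : ℕ) : Free K →ₗ[K] Free K →ₗ[K] Free K :=
  Finsupp.linearCombination K fun t => Finsupp.linearCombination K fun s =>
    Finsupp.single (Mon.graft t i s) (1 : K)

theorem comp_eq_compL (i : ℕ) (f g : Free K) : comp i f g = compL K i f g := by
  simp [comp, compL, Finsupp.linearCombination_apply, Finsupp.sum, LinearMap.sum_apply,
    Finset.smul_sum, mul_comm]

@[simp] theorem compL_single_single (i : ℕ) (t s : Mon) (a b : K) :
    compL K i (Finsupp.single t a) (Finsupp.single s b)
      = Finsupp.single (Mon.graft t i s) (a * b) := by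
  simp [compL]

theorem compL_single_left (i : ℕ) (t : Mon) (g : Free K) :
    compL K i (Finsupp.single t 1) g = Finsupp.mapDomain (Mon.graft t i) g := by
  induction g using Finsupp.induction_linear with
  | zero => simp
  | add f g hf hg => simp [hf, hg, Finsupp.mapDomain_add]
  | single s b => simp [Finsupp.mapDomain_single]

theorem compL_single_right (i : ℕ) (s : Mon) (f : Free K) :
    compL K i f (Finsupp.single s 1) = Finsupp.mapDomain (fun t => Mon.graft t i s) f := by
  induction f using Finsupp.induction_linear with
  | zero => simp
  | add f g hf hg => simp [hf, hg, Finsupp.mapDomain_add]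
  | single s b => simp [Finsupp.mapDomain_single]

theorem compL_mem_arity {m n i : ℕ} (hi : i < m) {f g : Free K} (hf : f ∈ arity K m)
    (hg : g ∈ arity K n) : compL K i f g ∈ arity K (m + n - 1) := by
  refine map_mem_of_mem_arity ((compL K i).flip g) _ (fun t ht => ?_) hf
  refine map_mem_of_mem_arity (compL K i (Finsupp.single t 1)) _ (fun s hs => ?_) hg
  rw [compL_single_single]
  exact single_mem_arity (by rw [Mon.numLeaves_graft _ _ _ (ht ▸ hi), ht, hs]) _

/-! ### The ideal generated by a set -/

theorem mem_idealGen {G : Set (Free K)} {n : ℕ} {f : Free K} :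
    f ∈ idealGen G n ↔ f ∈ arity K n ∧ ∀ C : ℕ → Submodule K (Free K), IsOperadIdeal C →
      (∀ g ∈ G, ∀ m, g ∈ arity K m → g ∈ C m) → f ∈ C n := by
  simp only [idealGen, Submodule.mem_inf, Submodule.mem_sInf, Set.mem_ofPred_eq]
  refine and_congr_right fun _ => ⟨fun h C hC hG => h _ ⟨C, hC, hG, rfl⟩, ?_⟩
  rintro h _ ⟨C, hC, hG, rfl⟩
  exact h C hC hG

theorem subset_idealGen {G : Set (Free K)} {n : ℕ} {g : Free K} (hg : g ∈ G)
    (hn : g ∈ arity K n) : g ∈ idealGen G n :=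
  mem_idealGen.2 ⟨hn, fun _ _ h => h g hg n hn⟩

theorem idealGen_le {G : Set (Free K)} {C : ℕ → Submodule K (Free K)} (hC : IsOperadIdeal C)
    (hG : ∀ g ∈ G, ∀ m, g ∈ arity K m → g ∈ C m) (n : ℕ) : idealGen G n ≤ C n :=
  fun _ hf => (mem_idealGen.1 hf).2 C hC hG

theorem isOperadIdeal_idealGen (G : Set (Free K)) : IsOperadIdeal (idealGen G) where
  le_arity _ := inf_le_left
  comp_left m n i hi f hf g hg := by
    rw [mem_idealGen] at hf ⊢
    refine ⟨?_, fun C hC hG => hC.comp_left m n i hi f (hf.2 C hC hG) g hg⟩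
    rw [comp_eq_compL]
    exact compL_mem_arity hi hf.1 hg
  comp_right m n i hi f hf g hg := by
    rw [mem_idealGen] at hg ⊢
    refine ⟨?_, fun C hC hG => hC.comp_right m n i hi f hf g (hg.2 C hC hG)⟩
    rw [comp_eq_compL]
    exact compL_mem_arity hi hf hg.1

/-! ### Leading monomials -/

theorem IsLeadingMonomial.unique {lt : Mon → Mon → Prop} (hlt : IsAdmissible lt) {n : ℕ}
    {f : Free K} (hf : f ∈ arity K n) {s t : Mon} (hs : IsLeadingMonomial lt f s)
    (ht : IsLeadingMonomial lt f t) : s = t := by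
  by_contra hne
  have e : s.numLeaves = t.numLeaves := by
    rw [mem_arity.1 hf s hs.1, mem_arity.1 hf t ht.1]
  exact hlt.irrefl s
    (hlt.trans s t s e e.symm (ht.2 s hs.1 hne) (hs.2 t ht.1 (Ne.symm hne)))

/-- Since no other monomial of arity `n` maps to `φ t`, its coefficient cannot cancel. -/
theorem IsLeadingMonomial.mapDomain {lt : Mon → Mon → Prop} {n : ℕ} {f : Free K}
    (hf : f ∈ arity K n) {t : Mon} (ht : IsLeadingMonomial lt f t) (φ : Mon → Mon)
    (hφ : ∀ s, s.numLeaves = n → φ s = φ t → s = t)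
    (hlt : ∀ s, s.numLeaves = n → lt s t → lt (φ s) (φ t)) :
    IsLeadingMonomial lt (Finsupp.mapDomain φ f) (φ t) := by
  classical
  refine ⟨?_, fun s hs hne => ?_⟩
  · have : Finsupp.mapDomain φ f (φ t) = f t := by
      rw [Finsupp.mapDomain, Finsupp.sum_apply, Finsupp.sum, Finset.sum_eq_single t]
      · simp
      · intro s hs hne
        exact Finsupp.single_eq_of_ne (fun e => hne (hφ s (mem_arity.1 hf s hs) e.symm))
      · intro h; exact absurd ht.1 h
    rw [Finsupp.mem_support_iff, this]
    exact Finsupp.mem_support_iff.1 ht.1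
  · obtain ⟨u, hu, rfl⟩ := Finset.mem_image.1 (Finsupp.mapDomain_support hs)
    exact hlt u (mem_arity.1 hf u hu) (ht.2 u hu (fun e => hne (e ▸ rfl)))

/-- By bilinearity it suffices to compose a leading monomial with a monomial, and the result is the
leading monomial of the corresponding composite in `C`. -/
theorem isOperadIdeal_leadingSpan {lt : Mon → Mon → Prop} (hlt : IsAdmissible lt)
    {C : ℕ → Submodule K (Free K)} (hC : IsOperadIdeal C) :
    IsOperadIdeal (leadingSpan lt C) where
  le_arity n := by
    refine Submodule.span_le.2 ?_
    rintro _ ⟨f, hf, t, ht, rfl⟩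
    exact single_mem_arity (mem_arity.1 (hC.le_arity n hf) t ht.1) 1
  comp_left m n i hi f hf g hg := by
    rw [comp_eq_compL]
    induction hf using Submodule.span_induction with
    | zero => simp
    | add x y _ _ hx hy => simpa using add_mem hx hy
    | smul a x _ hx => simpa using Submodule.smul_mem _ a hx
    | mem x hx =>
      obtain ⟨f, hf, t, ht, rfl⟩ := hx
      have hfm := hC.le_arity m hf
      have htm := mem_arity.1 hfm t ht.1
      refine map_mem_of_mem_arity (compL K i (Finsupp.single t 1)) _ (fun s hs => ?_) hg
      rw [compL_single_single, one_mul]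
      refine Submodule.subset_span ⟨_, hC.comp_left m n i hi f hf _ (single_mem_arity hs 1), _,
        ?_, rfl⟩
      rw [comp_eq_compL, compL_single_right]
      exact ht.mapDomain hfm (fun t => Mon.graft t i s)
        (fun u hu => hlt.graft_injective (hu.trans htm.symm) (hu ▸ hi))
        (fun u hu => hlt.graft_left u t s i (hu.trans htm.symm) (hu ▸ hi))
  comp_right m n i hi f hf g hg := by
    rw [comp_eq_compL]
    induction hg using Submodule.span_induction with
    | zero => simp
    | add x y _ _ hx hy => simpa using add_mem hx hy
    | smul a x _ hx => simpa using Submodule.smul_mem _ a hx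
    | mem x hx =>
      obtain ⟨g, hg, t, ht, rfl⟩ := hx
      have hgn := hC.le_arity n hg
      have htn := mem_arity.1 hgn t ht.1
      refine map_mem_of_mem_arity ((compL K i).flip (Finsupp.single t 1)) _ (fun s hs => ?_) hf
      rw [LinearMap.flip_apply, compL_single_single, one_mul]
      refine Submodule.subset_span ⟨_, hC.comp_right m n i hi _ (single_mem_arity hs 1) g hg, _,
        ?_, rfl⟩
      rw [comp_eq_compL, compL_single_left]
      exact ht.mapDomain hgn (Mon.graft s i)
        (fun u hu => hlt.graft_injective_right (hu.trans htn.symm) (hs ▸ hi))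
        (fun u hu => hlt.graft_right u t s i (hu.trans htn.symm) (hs ▸ hi))

/-! ### The weak associativity relation -/

@[simp] theorem op_single_single (s t : Mon) (a b : K) :
    op (Finsupp.single s a) (Finsupp.single t b)
      = Finsupp.single (BinaryTree.node () s t) (a * b) := by
  simp [op]

theorem op_input_sub (f g : Free K) : op (input K) (f - g) = op (input K) f - op (input K) g := by
  simp only [op, input]
  rw [Finsupp.sum_single_index (by simp), Finsupp.sum_single_index (by simp),
    Finsupp.sum_single_index (by simp), Finsupp.sum_sub_index]
  simp

theorem r_eq (k : ℕ) : r K k = Finsupp.single (leadTree k) 1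
    - Finsupp.single (Mon.comb (k - 2) (.node () .nil (.node () .nil .nil))) 1 := by
  have : ∀ (j : ℕ) (s t : Mon), (op (input K))^[j] (Finsupp.single s 1 - Finsupp.single t 1)
      = Finsupp.single (Mon.comb j s) 1 - Finsupp.single (Mon.comb j t) 1 := by
    intro j s t
    induction j with
    | zero => rfl
    | succ j ih =>
      rw [Function.iterate_succ_apply', ih, op_input_sub, Mon.comb_succ, Mon.comb_succ]
      simp [input]
  rw [r, show leadTree k = Mon.comb (k - 2) _ from rfl, ← this]
  simp [assoc, input]

theorem r_mem_arity (k : ℕ) : r K k ∈ arity K (k - 2 + 3) := by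
  rw [r_eq]
  exact sub_mem (single_mem_arity (Mon.numLeaves_comb _ _) 1)
    (single_mem_arity (Mon.numLeaves_comb _ _) 1)

theorem isLeadingMonomial_pathLex (k : ℕ) :
    IsLeadingMonomial pathLex (r K k) (leadTree k) := by
  classical
  set R := Mon.comb (k - 2) (.node () .nil (.node () .nil .nil)) with hR
  have hlt : pathLex R (leadTree k) := by
    have h0 : pathLex (.node () .nil (.node () .nil .nil)) (.node () (.node () .nil .nil) .nil) := by
      exact List.Lex.rel (by decide)
    have := pathLex_isAdmissible.graft_right (.node () .nil (.node () .nil .nil))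
      (.node () (.node () .nil .nil) .nil) (Mon.comb (k - 2) .nil) (k - 2 + 0)
      (by rfl) (by simp [Mon.numLeaves_comb, BinaryTree.numLeaves]) h0
    simp only [Mon.graft_comb, Mon.graft] at this
    exact this
  have hne : R ≠ leadTree k := fun e => pathLex_isAdmissible.irrefl _ (e ▸ hlt)
  rw [r_eq, ← hR]
  refine ⟨by simp [hne], fun s hs hne' => ?_⟩
  have : s = R := by
    by_contra h
    simp [Ne.symm h, Ne.symm hne'] at hs
  exact this ▸ hlt

/-! ### Relations lie in the kernel of the normal form map -/

/-- The linear extension of the normal form to the free operad. -/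
noncomputable def normalForm (K : Type*) [Field K] (m : ℕ) : Free K →ₗ[K] Free K :=
  Finsupp.lmapDomain K K fun t => Mon.nf m t m

@[simp] theorem normalForm_single (m : ℕ) (t : Mon) (a : K) :
    normalForm K m (Finsupp.single t a) = Finsupp.single (Mon.nf m t m) a := by
  simp [normalForm, Finsupp.mapDomain_single]

theorem normalForm_comp (m : ℕ) {n i : ℕ} (hi : i < n) {f : Free K} (hf : f ∈ arity K n)
    (g : Free K) : normalForm K m (compL K i f g)
      = normalForm K m (compL K i (normalForm K m f) (normalForm K m g)) := by
  let φ : Free K →ₗ[K] Free K := normalForm K m ∘ₗ (compL K i).flip g -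
    normalForm K m ∘ₗ (compL K i).flip (normalForm K m g) ∘ₗ normalForm K m
  have h : φ f ∈ (⊥ : Submodule K (Free K)) := by
    refine map_mem_of_mem_arity φ ⊥ (fun t ht => ?_) hf
    rw [Submodule.mem_bot]
    induction g using Finsupp.induction_linear with
    | zero => simp [φ]
    | add g g' hg hg' =>
      simp only [φ, LinearMap.sub_apply, LinearMap.comp_apply, LinearMap.flip_apply, sub_eq_zero,
        map_add, LinearMap.add_apply] at hg hg' ⊢
      rw [hg, hg']
    | single s b => simp [φ, ← Mon.nf_graft m t s i m (ht ▸ hi) le_rfl]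
  exact sub_eq_zero.1 ((Submodule.mem_bot K).1 h)

theorem isOperadIdeal_ker_normalForm (m : ℕ) :
    IsOperadIdeal fun n => arity K n ⊓ LinearMap.ker (normalForm K m) where
  le_arity _ := inf_le_left
  comp_left p n i hi f hf g hg := by
    rw [comp_eq_compL]
    refine ⟨compL_mem_arity hi hf.1 hg, ?_⟩
    rw [SetLike.mem_coe, LinearMap.mem_ker, normalForm_comp m hi hf.1, LinearMap.mem_ker.1 hf.2]
    simp
  comp_right p n i hi f hf g hg := by
    rw [comp_eq_compL]
    refine ⟨compL_mem_arity hi hf hg.1, ?_⟩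
    rw [SetLike.mem_coe, LinearMap.mem_ker, normalForm_comp m hi hf, LinearMap.mem_ker.1 hg.2]
    simp

theorem normalForm_r (k : ℕ) : normalForm K (k - 2) (r K k) = 0 := by
  have h : ∀ t : Mon, Mon.nf (k - 2) (Mon.comb (k - 2) t) (k - 2)
      = Mon.comb (k - 2) (Mon.comb t.numNodes .nil) := fun t => by
    have := Mon.nf_comb (k - 2) (k - 2) 0 t
    rwa [zero_add, Mon.nf_zero] at this
  rw [r_eq, map_sub, normalForm_single, normalForm_single,
    show leadTree k = Mon.comb (k - 2) _ from rfl, h, h]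
  exact sub_self _

theorem relationsQ_le_ker (k n : ℕ) :
    relationsQ K k n ≤ LinearMap.ker (normalForm K (k - 2)) := by
  refine le_trans (idealGen_le (isOperadIdeal_ker_normalForm (k - 2)) ?_ n) inf_le_right
  rintro _ rfl m hm
  exact ⟨hm, normalForm_r k⟩

/-- Being equal, or being larger and in the ideal generated by the leading monomial of `r_k`, is a
reduction. Hence a monomial that is not in normal form lies in this ideal. -/
theorem isReduction_of_isAdmissible (K : Type*) [Field K] {lt : Mon → Mon → Prop}
    (hlt : IsAdmissible lt) (k : ℕ)
    (h : lt (Mon.comb (k - 2) (.node () .nil (.node () .nil .nil))) (leadTree k)) :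
    Mon.IsReduction (k - 2) fun s t => s = t ∨ (s.numLeaves = t.numLeaves ∧ lt t s ∧
      Finsupp.single s 1 ∈ idealGen {Finsupp.single (leadTree k) (1 : K)} s.numLeaves) where
  refl t := .inl rfl
  trans s t u hst htu := by
    rcases hst with rfl | ⟨e, hst, hs⟩
    · exact htu
    · rcases htu with rfl | ⟨e', htu, -⟩
      · exact .inr ⟨e, hst, hs⟩
      · exact .inr ⟨e.trans e', hlt.trans u t s e'.symm e.symm htu hst, hs⟩
  graft_left s t u i hi hst := by
    rcases hst with rfl | ⟨e, hst, hs⟩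
    · exact .inl rfl
    · refine .inr ⟨?_, hlt.graft_left t s u i e.symm (e ▸ hi) hst, ?_⟩
      · rw [Mon.numLeaves_graft _ _ _ hi, Mon.numLeaves_graft _ _ _ (e ▸ hi), e]
      · have := (isOperadIdeal_idealGen _).comp_left _ _ i hi _ hs (Finsupp.single u 1)
          (single_mem_arity rfl 1)
        rwa [comp_eq_compL, compL_single_single, one_mul, ← Mon.numLeaves_graft _ _ _ hi] at this
  graft_right s t u i hi hst := by
    rcases hst with rfl | ⟨e, hst, hs⟩
    · exact .inl rfl
    · refine .inr ⟨?_, hlt.graft_right t s u i e.symm hi hst, ?_⟩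
      · rw [Mon.numLeaves_graft _ _ _ hi, Mon.numLeaves_graft _ _ _ hi, e]
      · have := (isOperadIdeal_idealGen _).comp_right _ _ i hi (Finsupp.single u 1)
          (single_mem_arity rfl 1) _ hs
        rwa [comp_eq_compL, compL_single_single, one_mul, ← Mon.numLeaves_graft _ _ _ hi] at this
  base := .inr ⟨by simp [Mon.numLeaves_comb, BinaryTree.numLeaves], h,
    subset_idealGen rfl (single_mem_arity rfl 1)⟩

/-- A leading monomial of an element killed by the normal form map is not in normal form. -/
theorem nf_ne_of_isLeadingMonomial {lt : Mon → Mon → Prop} (hlt : IsAdmissible lt) (m n : ℕ)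
    (hnf : ∀ s, Mon.nf m s m = s ∨ lt (Mon.nf m s m) s) {f : Free K} (hf : f ∈ arity K n)
    (h0 : normalForm K m f = 0) {t : Mon} (ht : IsLeadingMonomial lt f t) : Mon.nf m t m ≠ t := by
  classical
  intro e
  have h1 : normalForm K m f t = f t := by
    rw [normalForm, Finsupp.lmapDomain_apply, Finsupp.mapDomain, Finsupp.sum_apply, Finsupp.sum,
      Finset.sum_eq_single t]
    · simp [e]
    · intro s hs hne
      refine Finsupp.single_eq_of_ne fun e' => ?_
      have hst := ht.2 s hs hne
      rcases hnf s with hs' | hs'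
      · exact hne (hs'.symm.trans e'.symm)
      -- A monomial `s ≠ t` with normal form `t` would be larger than `t`, against `t` being
      -- leading.
      · rw [← e'] at hs'
        have el : s.numLeaves = t.numLeaves := by
          rw [mem_arity.1 hf s hs, mem_arity.1 hf t ht.1]
        exact hlt.irrefl s (hlt.trans s t s el el.symm hst hs')
    · intro h; exact absurd ht.1 h
  rw [h0] at h1
  exact Finsupp.mem_support_iff.1 ht.1 h1.symm

theorem isGroebnerBasis_r (k : ℕ) {lt : Mon → Mon → Prop} (hlt : IsAdmissible lt)
    (hr : IsLeadingMonomial lt (r K k) (leadTree k)) :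
    IsGroebnerBasis lt (relationsQ K k) {r K k} := by
  classical
  have hrel : r K k ∈ relationsQ K k (k - 2 + 3) := subset_idealGen rfl (r_mem_arity k)
  refine ⟨?_, fun n => ?_⟩
  · rintro _ rfl
    exact ⟨_, hrel⟩
  have hset : {x : Free K | ∃ g ∈ ({r K k} : Set (Free K)), ∃ t, IsLeadingMonomial lt g t ∧
      x = Finsupp.single t 1} = {Finsupp.single (leadTree k) (1 : K)} := by
    ext x
    constructor
    · rintro ⟨_, rfl, t, ht, rfl⟩
      rw [ht.unique hlt (r_mem_arity k) hr]
      rfl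
    · rintro rfl
      exact ⟨_, rfl, _, hr, rfl⟩
  rw [hset]
  apply le_antisymm
  · refine idealGen_le (isOperadIdeal_leadingSpan hlt (isOperadIdeal_idealGen _)) ?_ n
    rintro _ rfl m hm
    -- A nonzero monomial lies in one arity only, which fixes `m`.
    have hm' : m = k - 2 + 3 :=
      (numLeaves_of_single_mem_arity hm).symm.trans (Mon.numLeaves_comb _ _)
    subst hm'
    exact Submodule.subset_span ⟨_, hrel, _, hr, rfl⟩
  · refine Submodule.span_le.2 ?_
    rintro _ ⟨f, hf, t, ht, rfl⟩
    have hne : Mon.comb (k - 2) (.node () .nil (.node () .nil .nil)) ≠ leadTree k := by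
      intro e
      have := hr.1
      rw [r_eq, e] at this
      simp at this
    have hl : lt (Mon.comb (k - 2) (.node () .nil (.node () .nil .nil))) (leadTree k) := by
      refine hr.2 _ ?_ hne
      rw [r_eq]
      simp [hne.symm]
    have hred := (isReduction_of_isAdmissible K hlt k hl).nf
    have hfn : f ∈ arity K n := (isOperadIdeal_idealGen _).le_arity n hf
    have hnf := nf_ne_of_isLeadingMonomial hlt (k - 2) n
      (fun s => (hred s).imp Eq.symm fun h => h.2.1) hfn (relationsQ_le_ker k n hf) ht
    rcases hred t with e | ⟨-, -, h⟩
    · exact absurd e.symm hnf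
    · rwa [mem_arity.1 hfn t ht.1] at h

end WeakAssoc

theorem mainTheorem9 (K : Type*) [Field K] (k : ℕ) (hk : 2 < k) :
    (WeakAssoc.IsAdmissible WeakAssoc.pathLex ∧
      WeakAssoc.IsLeadingMonomial WeakAssoc.pathLex (WeakAssoc.r K k) (WeakAssoc.leadTree k)) ∧
    ∀ lt : WeakAssoc.Mon → WeakAssoc.Mon → Prop, WeakAssoc.IsAdmissible lt →
      WeakAssoc.IsLeadingMonomial lt (WeakAssoc.r K k) (WeakAssoc.leadTree k) →
      WeakAssoc.IsGroebnerBasis lt (WeakAssoc.relationsQ K k) {WeakAssoc.r K k} :=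
  ⟨⟨WeakAssoc.pathLex_isAdmissible, WeakAssoc.isLeadingMonomial_pathLex k⟩,
    fun _ hlt hr => WeakAssoc.isGroebnerBasis_r k hlt hr⟩
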